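/- **Setting.** Let $\mathcal X,\mathcal Y^1,\mathcal Y^2$ be nonempty $\sigma$-compact complete separable metric spaces and let $\mathcal U^1,\mathcal U^2$ be nonempty $\sigma$-compact Polish spaces, all with their Borel $\sigma$-algebras; products of metric spaces carry the maximum metric. Let $\mathbb P$ be a Borel probability measure on $\mathcal X\times\mathcal Y^1\times\mathcal Y^2$, the joint law of the state $x$ and the observations $y^1,y^2$ of two agents, and let $c:\mathcal X\times\mathcal Y^1\times\mathcal Y^2\times\mathcal U^1\times\mathcal U^2\to[0,\infty)$ be continuous. A behavioral strategy of Agent $i$ is a Markov kernel $\pi^i(du^i|y^i)$ from $\mathcal Y^i$ to $\mathcal U^i$; a deterministic strategy is a Borel map $\gamma^i:\mathcal Y^i\to\mathcal U^i$, identified with the kernel $y^i\mapsto\delta_{\gamma^i(y^i)}$. The expected cost is $$J(\pi^1,\pi^2)=\int\!\int c(x,y^1,y^2,u^1,u^2)\,\pi^1(du^1|y^1)\,\pi^2(du^2|y^2)\,\mathbb P(dx,dy^1,dy^2)\in[0,\infty].$$ **Condition C1.** Let $A$ be a metric space, $Y$ a topological space with a $\sigma$-algebra, $\eta:A\times Y\to\mathbb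 R$, and $\nu$ a measure on $Y$. The pair $(\eta,\nu)$ satisfies Condition C1 if $\eta$ is continuous and there is a bounded measurable $h:A\times Y\to[0,\infty)$ with $\sup_{a\in A}\int h(a,y)\,\nu(dy)<\infty$ such that for every $\epsilon>0$ there is $\delta>0$ such that $|\eta(a,y)-\eta(a_0,y)|<\epsilon\,h(a_0,y)$ for all $a_0,a\in A$ with $d(a,a_0)<\delta$ and all $y\in Y$. **Assumption (degraded observation).** For almost every $x$, $\mathbb P(dy^2,dy^1|x)=\mathbb P(dy^2|y^1)\,\mathbb P(dy^1|x)$, and there are measures $\nu_{\mathcal X},\nu_{\mathcal Y^1},\nu_{\mathcal Y^2}$ on $\mathcal X,\mathcal Y^1,\mathcal Y^2$ and bounded continuous functions $\eta^1,\eta^2,\rho^1,\rho^2$ such that, for almost every value of the conditioning variables, $$\begin{aligned} \mathbb P(dy^2|y^1)&=\eta^2(y^1,y^2)\,\nu_{\mathcal Y^2}(dy^2), & \mathbb P(dy^1|x,y^2)&=\eta^1(x,y^2,y^1)\,\nu_{\mathcal Y^1}(dy^1),\\ \mathbb P(dy^1,dx|y^2)&=\rho^2(y^2,y^1,x)\,\nu_{\mathcal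 Y^1}(dy^1)\,\nu_{\mathcal X}(dx), & \mathbb P(dx|y^1)&=\rho^1(y^1,x)\,\nu_{\mathcal X}(dx), \end{aligned}$$ and the pairs $(\eta^2,\nu_{\mathcal Y^2})$, $(\eta^1,\nu_{\mathcal Y^1})$, $(\rho^2,\nu_{\mathcal Y^1}\times\nu_{\mathcal X})$, $(\rho^1,\nu_{\mathcal X})$ satisfy Condition C1, with $A$ (the space of conditioning variables) equal to $\mathcal Y^1$, $\mathcal X\times\mathcal Y^2$, $\mathcal Y^2$, $\mathcal Y^1$ respectively. **Class IC.** A non-negative measurable function $\phi$ on $A\times B\times C$ (with $A,B$ topological spaces) is in $IC(A,B)$ if at least one of the following holds: (i) for every $M>0$ and every compact $K\subset A$ there is a compact $L\subset B$ with $\phi(a,b,k)\ge M$ for all $a\in K$, $b\notin L$, $k\in C$; (ii) for every $M>0$ and every $a_0\in A$ there are an open neighborhood $O$ of $a_0$ and a compact $L\subset B$ with $\phi(a,b,k)\ge M$ for all $a\in O$, $b\notin L$, $k\in C$. **Theorem.** Suppose that the degraded observation assumption holds. 1. (Team ST1.) If $\mathcal U^1$ and $\mathcal U^2$ are compact and $c$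 is bounded, then there are deterministic strategies $\gamma^1,\gamma^2$ with $J(\gamma^1,\gamma^2)\le J(\pi^1,\pi^2)$ for all behavioral strategies $\pi^1,\pi^2$. 2. (Team ST2.) If $c$ is in $IC(\mathcal X\times\mathcal Y^1\times\mathcal Y^2,\ \mathcal U^i)$ for $i=1,2$ (the third factor being the action space of the other agent) and some pair of behavioral strategies has finite expected cost, then there are deterministic strategies $\gamma^1,\gamma^2$ with $J(\gamma^1,\gamma^2)\le J(\pi^1,\pi^2)$ for all behavioral strategies $\pi^1,\pi^2$. -/

import Mathlib

open MeasureTheory ProbabilityTheory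
open scoped NNReal ENNReal

namespace StaticTeam

/-- The conditional law of `B` given `A` under `P` is `η(a, b) ν(db)`, for almost every value `a`
of `A`. (The identity `P(db | a) = η(a, b) ν(db)` forces `η(a, ·) ≥ 0` `ν`-a.e.) -/
def HasCondDensity {Ω α β : Type*} [MeasurableSpace Ω] [MeasurableSpace α]
    [MeasurableSpace β] [StandardBorelSpace β] [Nonempty β]
    (P : Measure Ω) [IsFiniteMeasure P] (B : Ω → β) (A : Ω → α)
    (η : α → β → ℝ) (ν : Measure β) : Prop :=
  ∀ᵐ a ∂(P.map A), (∀ᵐ b ∂ν, 0 ≤ η a b) ∧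
    condDistrib B A P a = ν.withDensity (fun b => ENNReal.ofReal (η a b))

/-- Condition C1 for the pair `(η, ν)`; `h` is the variation control function. Since the inequality
is strict, `h` is positive and `ν` is automatically σ-finite as soon as `α` is nonempty. -/
def ConditionC1 {α β : Type*} [MetricSpace α] [MeasurableSpace α]
    [TopologicalSpace β] [MeasurableSpace β] (η : α → β → ℝ) (ν : Measure β) : Prop :=
  Continuous (fun p : α × β => η p.1 p.2) ∧
  ∃ h : α → β → ℝ≥0,
    Measurable (fun p : α × β => h p.1 p.2) ∧
    (∃ C : ℝ≥0, ∀ a b, h a b ≤ C) ∧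
    (⨆ a, ∫⁻ b, (h a b : ℝ≥0∞) ∂ν) < ∞ ∧
    ∀ ε : ℝ, 0 < ε → ∃ δ : ℝ, 0 < δ ∧ ∀ a₀ a : α, dist a a₀ < δ →
      ∀ b : β, |η a b - η a₀ b| < ε * (h a₀ b : ℝ)

/-- `P(db | a) = η(a, b) ν(db)` with `η` bounded and `(η, ν)` satisfying Condition C1
(which includes continuity of `η`). -/
def HasC1CondDensity {Ω α β : Type*} [MeasurableSpace Ω] [MetricSpace α] [MeasurableSpace α]
    [TopologicalSpace β] [MeasurableSpace β] [StandardBorelSpace β] [Nonempty β]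
    (P : Measure Ω) [IsFiniteMeasure P] (B : Ω → β) (A : Ω → α) (ν : Measure β) : Prop :=
  ∃ η : α → β → ℝ, (∃ C : ℝ, ∀ a b, |η a b| ≤ C) ∧
    HasCondDensity P B A η ν ∧ ConditionC1 η ν

section Team

variable {𝓧 𝓨₁ 𝓨₂ 𝓤₁ 𝓤₂ : Type*}

/-- Hypothesis on the joint law `P` of `(x, y₁, y₂)` saying that `y₂` is a degraded version of `y₁`:
`P(dy₂, dy₁ | x) = P(dy₂ | y₁) P(dy₁ | x)`, and the conditional laws
`P(dy₁ | x, y₂)`, `P(dy₂ | y₁)`, `P(dx | y₁)`, `P(dy₁, dx | y₂)` have bounded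
densities, satisfying Condition C1, with respect to reference measures `νY₁`, `νY₂`, `νX`,
`νY₁ × νX`. -/
def DegradedObservation
    [MetricSpace 𝓧] [CompleteSpace 𝓧] [SecondCountableTopology 𝓧] [Nonempty 𝓧]
    [MeasurableSpace 𝓧] [BorelSpace 𝓧]
    [MetricSpace 𝓨₁] [CompleteSpace 𝓨₁] [SecondCountableTopology 𝓨₁] [Nonempty 𝓨₁]
    [MeasurableSpace 𝓨₁] [BorelSpace 𝓨₁]
    [MetricSpace 𝓨₂] [CompleteSpace 𝓨₂] [SecondCountableTopology 𝓨₂] [Nonempty 𝓨₂]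
    [MeasurableSpace 𝓨₂] [BorelSpace 𝓨₂]
    (P : Measure (𝓧 × 𝓨₁ × 𝓨₂)) [IsProbabilityMeasure P] : Prop :=
  let x : 𝓧 × 𝓨₁ × 𝓨₂ → 𝓧 := fun ω => ω.1
  let y₁ : 𝓧 × 𝓨₁ × 𝓨₂ → 𝓨₁ := fun ω => ω.2.1
  let y₂ : 𝓧 × 𝓨₁ × 𝓨₂ → 𝓨₂ := fun ω => ω.2.2
  (∀ᵐ s ∂(P.map x), condDistrib (fun ω => (y₁ ω, y₂ ω)) x P s =
    (condDistrib y₁ x P ⊗ₖ Kernel.prodMkLeft 𝓧 (condDistrib y₂ y₁ P)) s) ∧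
  ∃ (νX : Measure 𝓧) (νY₁ : Measure 𝓨₁) (νY₂ : Measure 𝓨₂),
    HasC1CondDensity P y₂ y₁ νY₂ ∧
    HasC1CondDensity P y₁ (fun ω => (x ω, y₂ ω)) νY₁ ∧
    HasC1CondDensity P (fun ω => (y₁ ω, x ω)) y₂ (νY₁.prod νX) ∧
    HasC1CondDensity P x y₁ νX

/-- Expected cost of the behavioral strategies `π₁`, `π₂` (Markov kernels), as an element
of `[0, ∞]`. -/
noncomputable def expectedCost
    [MeasurableSpace 𝓧] [MeasurableSpace 𝓨₁] [MeasurableSpace 𝓨₂]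
    [MeasurableSpace 𝓤₁] [MeasurableSpace 𝓤₂]
    (P : Measure (𝓧 × 𝓨₁ × 𝓨₂)) (c : 𝓧 × 𝓨₁ × 𝓨₂ → 𝓤₁ → 𝓤₂ → ℝ≥0)
    (π₁ : Kernel 𝓨₁ 𝓤₁) (π₂ : Kernel 𝓨₂ 𝓤₂) : ℝ≥0∞ :=
  ∫⁻ ω, ∫⁻ u, (c ω u.1 u.2 : ℝ≥0∞) ∂((π₁ ω.2.1).prod (π₂ ω.2.2)) ∂P

/-- Some pair of deterministic (Borel measurable) strategies minimizes the expected cost among all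
pairs of behavioral strategies. -/
def AdmitsDeterministicOptimum
    [MeasurableSpace 𝓧] [MeasurableSpace 𝓨₁] [MeasurableSpace 𝓨₂]
    [MeasurableSpace 𝓤₁] [MeasurableSpace 𝓤₂]
    (P : Measure (𝓧 × 𝓨₁ × 𝓨₂)) (c : 𝓧 × 𝓨₁ × 𝓨₂ → 𝓤₁ → 𝓤₂ → ℝ≥0) : Prop :=
  ∃ (γ₁ : 𝓨₁ → 𝓤₁) (γ₂ : 𝓨₂ → 𝓤₂) (h₁ : Measurable γ₁) (h₂ : Measurable γ₂),
    ∀ (π₁ : Kernel 𝓨₁ 𝓤₁) (π₂ : Kernel 𝓨₂ 𝓤₂), IsMarkovKernel π₁ → IsMarkovKernel π₂ →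
      expectedCost P c (Kernel.deterministic γ₁ h₁) (Kernel.deterministic γ₂ h₂) ≤
        expectedCost P c π₁ π₂

end Team

/-- The class `IC(α, β)` of non-negative measurable functions on `α × β × κ`. -/
def ClassIC {α β κ : Type*} [TopologicalSpace α] [MeasurableSpace α]
    [TopologicalSpace β] [MeasurableSpace β] [MeasurableSpace κ]
    (φ : α → β → κ → ℝ≥0) : Prop :=
  Measurable (fun p : α × β × κ => φ p.1 p.2.1 p.2.2) ∧
  ((∀ M : ℝ≥0, 0 < M → ∀ K : Set α, IsCompact K →
      ∃ L : Set β, IsCompact L ∧ ∀ a ∈ K, ∀ b ∉ L, ∀ k, M ≤ φ a b k) ∨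
   (∀ M : ℝ≥0, 0 < M → ∀ a₀ : α, ∃ O : Set α, IsOpen O ∧ a₀ ∈ O ∧
      ∃ L : Set β, IsCompact L ∧ ∀ a ∈ O, ∀ b ∉ L, ∀ k, M ≤ φ a b k))

end StaticTeam

namespace StaticTeam

open Filter Topology BoundedContinuousFunction

/-! The proof is the direct method, after a change of measure that makes the observations
independent. The degraded observation assumption makes `x`, `y₁`, `y₂` a Markov chain whose laws of
`x` and of `y₂` given `y₁` have densities. Hence `P` is dominated by the product `Q` of its
marginals (`DegradedObservation.absolutelyContinuous_prod_marginals`).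

Under `Q` the pairs `(y₁, u₁)` and `(y₂, u₂)` are independent, so weak convergence of their separate
laws gives weak convergence of the joint law. Returning to `P` multiplies by a density that is only
integrable. This preserves weak convergence because the law of `(x, y₁, y₂)` is the same along the
sequence (`tendsto_withDensity_fst`). The cost is therefore lower semicontinuous
(`expectedCost_le_liminf`).

Along a minimizing sequence class `IC` gives tight actions, and Prokhorov's theorem with
disintegration gives limiting kernels. Finally each kernel is a mixture of deterministic maps, one
of which does no worse than the average (`exists_measurable_lintegral_le`). The compact case is an
instance of the `IC` case. -/

/-! ### Domination by the product of the marginals -/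

/-- Split a null set of the new product according to whether its section is `ν`-null. The base
points with non-null section are `R.fst`-null; over the other base points the set is null for
`μ.prod ν`, hence for `R`. This replaces an unspecified reference measure by the marginal. -/
theorem absolutelyContinuous_fst_prod {α β : Type*} [MeasurableSpace α] [MeasurableSpace β]
    {R : Measure (α × β)} [IsFiniteMeasure R] {μ : Measure α} {ν : Measure β}
    [SFinite ν] (h : R ≪ μ.prod ν) : R ≪ R.fst.prod ν := by
  refine Measure.AbsolutelyContinuous.mk fun s hs h0 => ?_
  rw [Measure.measure_prod_null hs] at h0
  set B : Set α := {a | ν (Prod.mk a ⁻¹' s) ≠ 0} with hBdef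
  have hB : MeasurableSet B :=
    measurable_measure_prodMk_left hs (MeasurableSet.singleton (0 : ℝ≥0∞)).compl
  have hRB : R (Prod.fst ⁻¹' B) = 0 := by
    rw [← Measure.fst_apply hB]
    exact h0
  have hsB : R (s \ Prod.fst ⁻¹' B) = 0 := by
    apply h
    refine Measure.measure_prod_null_of_ae_null (hs.diff (measurable_fst hB))
      (Filter.Eventually.of_forall fun a => ?_)
    by_cases ha : a ∈ B
    · have : Prod.mk a ⁻¹' (s \ Prod.fst ⁻¹' B) = ∅ := by
        ext b
        simp [ha]
      simp [this]
    · have ha' : ν (Prod.mk a ⁻¹' s) = 0 := by simpa [hBdef] using ha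
      exact measure_mono_null (fun b hb => hb.1) ha'
  exact measure_mono_null (t := Prod.fst ⁻¹' B ∪ s \ Prod.fst ⁻¹' B)
    (fun p hp => by by_cases h' : p ∈ Prod.fst ⁻¹' B <;> simp_all) (measure_union_null hRB hsB)

theorem absolutelyContinuous_prod_snd {α β : Type*} [MeasurableSpace α] [MeasurableSpace β]
    {R : Measure (α × β)} [IsFiniteMeasure R] {μ : Measure α} {ν : Measure β}
    [SFinite μ] [SFinite ν] (h : R ≪ μ.prod ν) : R ≪ μ.prod R.snd := by
  have h1 : R.map Prod.swap ≪ ν.prod μ := by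
    rw [← Measure.prod_swap]
    exact h.map measurable_swap
  have h2 := (absolutelyContinuous_fst_prod h1).map measurable_swap
  rw [Measure.map_map measurable_swap measurable_swap, Measure.prod_swap,
    Measure.fst_map_swap] at h2
  simpa using h2

/-- Taking `a = a₀` in the strict inequality forces `h > 0`, so `ν` is absolutely continuous with
respect to the finite measure `h(a, ·) ν`. Product measures built from `ν` need this. -/
theorem ConditionC1.sFinite {α β : Type*} [MetricSpace α] [MeasurableSpace α] [Nonempty α]
    [TopologicalSpace β] [MeasurableSpace β] {η : α → β → ℝ} {ν : Measure β}
    (h : ConditionC1 η ν) : SFinite ν := by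
  obtain ⟨-, h, hm, -, hfin, hvar⟩ := h
  obtain ⟨a⟩ := ‹Nonempty α›
  have hpos : ∀ b, h a b ≠ 0 := by
    intro b hb
    obtain ⟨δ, hδ, H⟩ := hvar 1 one_pos
    have := H a a (by simpa using hδ) b
    simp [hb] at this
  have hma : Measurable (h a) := hm.comp measurable_prodMk_left
  have : IsFiniteMeasure (ν.withDensity fun b => (h a b : ℝ≥0∞)) :=
    isFiniteMeasure_withDensity ((le_iSup (fun a => ∫⁻ b, (h a b : ℝ≥0∞) ∂ν) a).trans_lt hfin).ne
  exact sFinite_of_absolutelyContinuous (withDensity_absolutelyContinuous'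
    (hma.coe_nnreal_ennreal).aemeasurable (Filter.Eventually.of_forall fun b => by simp [hpos b]))

theorem HasCondDensity.map_prodMk_absolutelyContinuous {Ω α β : Type*} [MeasurableSpace Ω]
    [MeasurableSpace α] [MeasurableSpace β] [StandardBorelSpace β] [Nonempty β]
    {P : Measure Ω} [IsFiniteMeasure P] {B : Ω → β} {A : Ω → α}
    {η : α → β → ℝ} {ν : Measure β} [SFinite ν] (h : HasCondDensity P B A η ν)
    (hB : Measurable B) :
    P.map (fun ω => (A ω, B ω)) ≪ (P.map A).prod ν := by
  rw [← compProd_map_condDistrib (X := A) hB.aemeasurable, ← Measure.compProd_const]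
  refine Measure.AbsolutelyContinuous.compProd_right ?_
  filter_upwards [h] with a ha
  rw [ha.2, Kernel.const_apply]
  exact withDensity_absolutelyContinuous _ _

section

variable {𝓧 𝓨₁ 𝓨₂ : Type*}
    [MetricSpace 𝓧] [CompleteSpace 𝓧] [SecondCountableTopology 𝓧] [Nonempty 𝓧]
    [MeasurableSpace 𝓧] [BorelSpace 𝓧]
    [MetricSpace 𝓨₁] [CompleteSpace 𝓨₁] [SecondCountableTopology 𝓨₁] [Nonempty 𝓨₁]
    [MeasurableSpace 𝓨₁] [BorelSpace 𝓨₁]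
    [MetricSpace 𝓨₂] [CompleteSpace 𝓨₂] [SecondCountableTopology 𝓨₂] [Nonempty 𝓨₂]
    [MeasurableSpace 𝓨₂] [BorelSpace 𝓨₂]

/-- Under degraded observations the joint law is dominated by the product of its marginals. -/
theorem DegradedObservation.absolutelyContinuous_prod_marginals
    {P : Measure (𝓧 × 𝓨₁ × 𝓨₂)} [IsProbabilityMeasure P] (hP : DegradedObservation P) :
    P ≪ (P.map (fun ω => ω.1)).prod
      ((P.map (fun ω => ω.2.1)).prod (P.map (fun ω => ω.2.2))) := by
  obtain ⟨hci, νX, νY₁, νY₂, ⟨η, -, hη, hηC⟩, -, -, ⟨ρ, -, hρ, hρC⟩⟩ := hP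
  have : SFinite νX := hρC.sFinite
  have : SFinite νY₂ := hηC.sFinite
  have hx : Measurable (fun ω : 𝓧 × 𝓨₁ × 𝓨₂ => ω.1) := by fun_prop
  have hy₁ : Measurable (fun ω : 𝓧 × 𝓨₁ × 𝓨₂ => ω.2.1) := by fun_prop
  have hy₂ : Measurable (fun ω : 𝓧 × 𝓨₁ × 𝓨₂ => ω.2.2) := by fun_prop
  have : IsProbabilityMeasure (P.map (fun ω => ω.1)) :=
    Measure.isProbabilityMeasure_map hx.aemeasurable
  have : IsProbabilityMeasure (P.map (fun ω => ω.2.1)) :=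
    Measure.isProbabilityMeasure_map hy₁.aemeasurable
  have : IsProbabilityMeasure (P.map (fun ω => ω.2.2)) :=
    Measure.isProbabilityMeasure_map hy₂.aemeasurable
  set R : Measure (𝓧 × 𝓨₁) := P.map (fun ω => (ω.1, ω.2.1)) with hR
  have : IsProbabilityMeasure R := Measure.isProbabilityMeasure_map (by fun_prop)
  have hRac : R ≪ (P.map (fun ω => ω.1)).prod (P.map (fun ω => ω.2.1)) := by
    have h1 := (hρ.map_prodMk_absolutelyContinuous hx).map measurable_swap
    rw [Measure.map_map measurable_swap (by fun_prop), Measure.prod_swap] at h1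
    have h2 := absolutelyContinuous_fst_prod (R := R) h1
    rwa [hR, Measure.fst_map_prodMk hy₁] at h2
  set κ := condDistrib (fun ω : 𝓧 × 𝓨₁ × 𝓨₂ => ω.2.2) (fun ω => ω.2.1) P with hκ
  set S : Measure ((𝓧 × 𝓨₁) × 𝓨₂) := P.map (fun ω => ((ω.1, ω.2.1), ω.2.2)) with hS
  -- The Markov property: given `(x, y₁)`, the law of `y₂` depends on `y₁` alone.
  have hSeq : S = R ⊗ₘ Kernel.prodMkLeft 𝓧 κ := by
    have h1 : P = (P.map (fun ω => ω.1)) ⊗ₘ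
        (condDistrib (fun ω : 𝓧 × 𝓨₁ × 𝓨₂ => ω.2.1) (fun ω => ω.1) P ⊗ₖ
          Kernel.prodMkLeft 𝓧 κ) := by
      rw [← Measure.compProd_congr hci, compProd_map_condDistrib (by fun_prop)]
      exact Measure.map_id.symm
    rw [hR, ← compProd_map_condDistrib hy₁.aemeasurable, ← Measure.compProd_assoc, ← h1]
    rfl
  have hSac : S ≪ R.prod (P.map (fun ω => ω.2.2)) := by
    have h1 : S ≪ R.prod νY₂ := by
      rw [hSeq, ← Measure.compProd_const]
      refine Measure.AbsolutelyContinuous.compProd_right ?_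
      have : ∀ᵐ a ∂(R.map Prod.snd), κ a = νY₂.withDensity (fun b => ENNReal.ofReal (η a b)) := by
        rw [hR, Measure.map_map measurable_snd (by fun_prop)]
        filter_upwards [hη] with a ha using ha.2
      filter_upwards [ae_of_ae_map (by fun_prop) this] with a ha
      rw [Kernel.prodMkLeft_apply, ha, Kernel.const_apply]
      exact withDensity_absolutelyContinuous _ _
    have h2 := absolutelyContinuous_prod_snd h1
    rwa [hS, Measure.snd_map_prodMk (by fun_prop)] at h2
  have h3 := (hSac.trans (hRac.prod Measure.AbsolutelyContinuous.rfl)).map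
    (MeasurableEquiv.prodAssoc (α := 𝓧) (β := 𝓨₁) (γ := 𝓨₂)).measurable
  rw [Measure.prodAssoc_prod, hS, Measure.map_map (MeasurableEquiv.measurable _) (by fun_prop)] at h3
  convert h3
  exact Measure.map_id.symm

end

/-! ### Weak convergence under an integrable reweighting -/

/-- Weak convergence of measures with a common first marginal `Q` is preserved by reweighting with
an integrable, not necessarily continuous, density of the first coordinate. -/
theorem tendsto_integral_mul_fst_of_tendsto {ι E F : Type*} {l : Filter ι}
    [TopologicalSpace E] [NormalSpace E] [MeasurableSpace E] [BorelSpace E]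
    [TopologicalSpace F] [MeasurableSpace F]
    [OpensMeasurableSpace (E × F)]
    {Q : Measure E} [Q.WeaklyRegular] [IsFiniteMeasure Q]
    {M : ι → ProbabilityMeasure (E × F)} {M' : ProbabilityMeasure (E × F)}
    (hM : ∀ i, (M i : Measure (E × F)).fst = Q) (hM' : (M' : Measure (E × F)).fst = Q)
    (hlim : Tendsto M l (𝓝 M')) {D : E → ℝ} (hD : Integrable D Q) (f : E × F →ᵇ ℝ) :
    Tendsto (fun i => ∫ p, D p.1 * f p ∂(M i : Measure (E × F))) l
      (𝓝 (∫ p, D p.1 * f p ∂(M' : Measure (E × F)))) := by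
  -- The error of replacing `D` by `g` is an integral against the common marginal `Q`, so it is
  -- uniform along the sequence.
  have happrox : ∀ (g : E →ᵇ ℝ) (N : ProbabilityMeasure (E × F)),
      (N : Measure (E × F)).fst = Q →
      |∫ p, D p.1 * f p ∂(N : Measure (E × F)) - ∫ p, g p.1 * f p ∂(N : Measure (E × F))| ≤
        (∫ x, ‖D x - g x‖ ∂Q) * ‖f‖ := by
    intro g N hN
    have hint : ∀ h : E → ℝ, Integrable h Q →
        Integrable (fun p : E × F => h p.1) (N : Measure (E × F)) := fun h hh => by
      rw [← hN] at hh
      exact hh.comp_measurable measurable_fst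
    have hintf : ∀ h : E → ℝ, Integrable h Q →
        Integrable (fun p : E × F => h p.1 * f p) (N : Measure (E × F)) := fun h hh =>
      (hint h hh).mul_bdd (c := ‖f‖) f.continuous.aestronglyMeasurable
        (Eventually.of_forall f.norm_coe_le_norm)
    have hg : Integrable (fun x => g x) Q := g.integrable Q
    rw [← integral_sub (hintf D hD) (hintf _ hg), ← Real.norm_eq_abs]
    calc _ ≤ ∫ p, ‖D p.1 - g p.1‖ * ‖f‖ ∂(N : Measure (E × F)) := by
          refine norm_integral_le_of_norm_le ((hint _ (hD.sub hg).norm).mul_const _)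
            (Eventually.of_forall fun p => ?_)
          rw [← sub_mul, norm_mul]
          gcongr
          exact f.norm_coe_le_norm p
      _ = _ := by
          rw [integral_mul_const, ← hN, Measure.fst, integral_map measurable_fst.aemeasurable]
          rw [← Measure.fst, hN]
          exact (hD.sub hg).norm.aestronglyMeasurable
  rw [Metric.tendsto_nhds]
  intro ε hε
  -- One third for each of the two approximations and for the convergence; the `+ 1` covers `f = 0`.
  set δ : ℝ := ε / (3 * (‖f‖ + 1)) with hδdef
  have hf0 : 0 ≤ ‖f‖ := norm_nonneg f
  have hδ : 0 < δ := by positivity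
  obtain ⟨g, hgD, -⟩ := hD.exists_boundedContinuous_integral_sub_le hδ
  have hδf : (∫ x, ‖D x - g x‖ ∂Q) * ‖f‖ < ε / 3 := by
    calc _ ≤ δ * ‖f‖ := by gcongr
      _ < δ * (‖f‖ + 1) := by nlinarith
      _ = ε / 3 := by rw [hδdef]; field_simp
  have hcont := (ProbabilityMeasure.tendsto_iff_forall_integral_tendsto.mp hlim)
    ((g.compContinuous ⟨Prod.fst, continuous_fst⟩) * f)
  filter_upwards [Metric.tendsto_nhds.mp hcont (ε / 3) (by positivity)] with i hi
  have h1 := happrox g (M i) (hM i)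
  have h2 := happrox g M' hM'
  rw [Real.dist_eq] at hi ⊢
  have hi' : |∫ p, g p.1 * f p ∂(M i : Measure (E × F)) -
      ∫ p, g p.1 * f p ∂(M' : Measure (E × F))| < ε / 3 := hi
  rw [abs_le] at h1 h2
  rw [abs_lt] at hi' ⊢
  constructor <;> linarith

theorem tendsto_withDensity_fst {ι E F : Type*} {l : Filter ι}
    [TopologicalSpace E] [NormalSpace E] [MeasurableSpace E] [BorelSpace E]
    [TopologicalSpace F] [MeasurableSpace F]
    [OpensMeasurableSpace (E × F)]
    {Q : Measure E} [Q.WeaklyRegular] [IsFiniteMeasure Q]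
    {M N : ι → ProbabilityMeasure (E × F)} {M' N' : ProbabilityMeasure (E × F)}
    (hM : ∀ i, (M i : Measure (E × F)).fst = Q) (hM' : (M' : Measure (E × F)).fst = Q)
    (hlim : Tendsto M l (𝓝 M')) {D : E → ℝ≥0∞} (hDm : Measurable D) (hD : ∫⁻ x, D x ∂Q ≠ ∞)
    (hN : ∀ i, (N i : Measure (E × F)) = (M i : Measure (E × F)).withDensity fun p => D p.1)
    (hN' : (N' : Measure (E × F)) = (M' : Measure (E × F)).withDensity fun p => D p.1) :
    Tendsto N l (𝓝 N') := by
  rw [ProbabilityMeasure.tendsto_iff_forall_integral_tendsto]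
  intro f
  have key : ∀ (A B : ProbabilityMeasure (E × F)), (A : Measure (E × F)).fst = Q →
      (B : Measure (E × F)) = (A : Measure (E × F)).withDensity (fun p => D p.1) →
      ∫ p, f p ∂(B : Measure (E × F)) = ∫ p, (D p.1).toReal * f p ∂(A : Measure (E × F)) := by
    intro A B hA hB
    rw [hB, integral_withDensity_eq_integral_toReal_smul (by fun_prop)]
    · rfl
    · refine ae_lt_top (by fun_prop) ?_
      rwa [← hA, Measure.fst, lintegral_map hDm measurable_fst] at hD
  rw [key M' N' hM' hN']
  simp_rw [fun i => key (M i) (N i) (hM i) (hN i)]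
  exact tendsto_integral_mul_fst_of_tendsto hM hM' hlim
    (integrable_toReal_of_lintegral_ne_top hDm.aemeasurable hD) f

/-! ### Joint laws of states, observations and actions -/

section TeamLaw

variable {𝓧 𝓨₁ 𝓨₂ 𝓤₁ 𝓤₂ : Type*} [MeasurableSpace 𝓧] [MeasurableSpace 𝓨₁] [MeasurableSpace 𝓨₂]
  [MeasurableSpace 𝓤₁] [MeasurableSpace 𝓤₂]

/-- The kernel sending `(x, y₁, y₂)` to `π₁(· | y₁) × π₂(· | y₂)`. -/
noncomputable def teamKernel (π₁ : Kernel 𝓨₁ 𝓤₁) (π₂ : Kernel 𝓨₂ 𝓤₂) :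
    Kernel (𝓧 × 𝓨₁ × 𝓨₂) (𝓤₁ × 𝓤₂) :=
  (π₁.comap (fun ω : 𝓧 × 𝓨₁ × 𝓨₂ => ω.2.1) (by fun_prop)) ×ₖ
    (π₂.comap (fun ω : 𝓧 × 𝓨₁ × 𝓨₂ => ω.2.2) (by fun_prop))

instance (π₁ : Kernel 𝓨₁ 𝓤₁) (π₂ : Kernel 𝓨₂ 𝓤₂) [IsMarkovKernel π₁] [IsMarkovKernel π₂] :
    IsMarkovKernel (teamKernel (𝓧 := 𝓧) π₁ π₂) := by
  unfold teamKernel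
  infer_instance

theorem teamKernel_apply (π₁ : Kernel 𝓨₁ 𝓤₁) (π₂ : Kernel 𝓨₂ 𝓤₂) [IsMarkovKernel π₁]
    [IsMarkovKernel π₂] (ω : 𝓧 × 𝓨₁ × 𝓨₂) :
    teamKernel π₁ π₂ ω = (π₁ ω.2.1).prod (π₂ ω.2.2) := by
  rw [teamKernel, Kernel.prod_apply, Kernel.comap_apply, Kernel.comap_apply]

theorem expectedCost_eq_lintegral_compProd {P : Measure (𝓧 × 𝓨₁ × 𝓨₂)} [SFinite P]
    {c : 𝓧 × 𝓨₁ × 𝓨₂ → 𝓤₁ → 𝓤₂ → ℝ≥0}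
    (hc : Measurable fun p : (𝓧 × 𝓨₁ × 𝓨₂) × 𝓤₁ × 𝓤₂ => c p.1 p.2.1 p.2.2)
    (π₁ : Kernel 𝓨₁ 𝓤₁) (π₂ : Kernel 𝓨₂ 𝓤₂) [IsMarkovKernel π₁] [IsMarkovKernel π₂] :
    expectedCost P c π₁ π₂ =
      ∫⁻ p, (c p.1 p.2.1 p.2.2 : ℝ≥0∞) ∂(P ⊗ₘ teamKernel π₁ π₂) := by
  rw [Measure.lintegral_compProd hc.coe_nnreal_ennreal, expectedCost]
  simp_rw [teamKernel_apply]

theorem withDensity_compProd_eq {α β : Type*} [MeasurableSpace α] [MeasurableSpace β]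
    (Q : Measure α) [SFinite Q] {D : α → ℝ≥0∞} (hD : Measurable D) (κ : Kernel α β)
    [IsSFiniteKernel κ] :
    Q.withDensity D ⊗ₘ κ = (Q ⊗ₘ κ).withDensity fun p => D p.1 := by
  refine Measure.ext_of_lintegral _ fun f hf => ?_
  rw [Measure.lintegral_compProd hf, lintegral_withDensity_eq_lintegral_mul _ hD (by fun_prop),
    lintegral_withDensity_eq_lintegral_mul _ (by fun_prop) hf,
    Measure.lintegral_compProd (by fun_prop)]
  refine lintegral_congr fun a => ?_
  simp only [Pi.mul_apply]
  rw [lintegral_const_mul _ (by fun_prop)]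

/-- With independent observations the two agents decouple: each action depends only on its own
observation. This is what lets the strategies converge separately. -/
theorem prod_compProd_teamKernel (μ : Measure 𝓧) (μ₁ : Measure 𝓨₁) (μ₂ : Measure 𝓨₂)
    [SFinite μ] [SFinite μ₁] [SFinite μ₂] (π₁ : Kernel 𝓨₁ 𝓤₁) (π₂ : Kernel 𝓨₂ 𝓤₂)
    [IsMarkovKernel π₁] [IsMarkovKernel π₂] :
    (μ.prod (μ₁.prod μ₂)) ⊗ₘ teamKernel π₁ π₂ =
      (μ.prod ((μ₁ ⊗ₘ π₁).prod (μ₂ ⊗ₘ π₂))).map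
        (fun q => ((q.1, q.2.1.1, q.2.2.1), q.2.1.2, q.2.2.2)) := by
  refine Measure.ext_of_lintegral _ fun f hf => ?_
  have hI : Measurable fun ω => ∫⁻ u, f (ω, u) ∂(teamKernel π₁ π₂ ω) :=
    hf.lintegral_kernel_prod_right'
  rw [Measure.lintegral_compProd hf, lintegral_map hf (by fun_prop),
    lintegral_prod _ hI.aemeasurable, lintegral_prod _ (by fun_prop)]
  refine lintegral_congr fun x => ?_
  have hIx : Measurable fun y => ∫⁻ u, f ((x, y), u) ∂(teamKernel π₁ π₂ (x, y)) :=
    hI.comp measurable_prodMk_left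
  rw [lintegral_prod _ hIx.aemeasurable, lintegral_prod _ (by fun_prop),
    Measure.lintegral_compProd (by fun_prop)]
  refine lintegral_congr fun y₁ => ?_
  simp_rw [teamKernel_apply]
  have h1 : ∀ u₁, ∫⁻ q : 𝓨₂ × 𝓤₂, f ((x, y₁, q.1), u₁, q.2) ∂(μ₂ ⊗ₘ π₂) =
      ∫⁻ y₂, ∫⁻ u₂, f ((x, y₁, y₂), u₁, u₂) ∂(π₂ y₂) ∂μ₂ := fun u₁ =>
    Measure.lintegral_compProd (by fun_prop)
  simp_rw [h1]
  -- The law of `u₁` does not depend on `y₂`, so Tonelli exchanges the two.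
  rw [lintegral_lintegral_swap]
  · refine lintegral_congr fun y₂ => ?_
    rw [lintegral_prod _ (by fun_prop)]
  · refine Measurable.aemeasurable ?_
    refine Measurable.lintegral_kernel_prod_right'
      (κ := π₂.comap (fun q : 𝓤₁ × 𝓨₂ => q.2) measurable_snd)
      (f := fun q : (𝓤₁ × 𝓨₂) × 𝓤₂ => f ((x, y₁, q.1.2), q.1.1, q.2)) (by fun_prop)

/-- The other agent's action integrates out. Tightness of actions obtained under the full law thus
passes to the pair `(y₁, u₁)`. -/
theorem map_compProd_teamKernel_left (P : Measure (𝓧 × 𝓨₁ × 𝓨₂)) [SFinite P]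
    (π₁ : Kernel 𝓨₁ 𝓤₁) (π₂ : Kernel 𝓨₂ 𝓤₂) [IsMarkovKernel π₁] [IsMarkovKernel π₂] :
    (P ⊗ₘ teamKernel π₁ π₂).map (fun p => (p.1.2.1, p.2.1)) =
      (P.map fun ω => ω.2.1) ⊗ₘ π₁ := by
  refine Measure.ext_of_lintegral _ fun f hf => ?_
  rw [lintegral_map hf (by fun_prop), Measure.lintegral_compProd (by fun_prop),
    Measure.lintegral_compProd hf, lintegral_map (by fun_prop) (by fun_prop)]
  refine lintegral_congr fun ω => ?_
  rw [teamKernel_apply, lintegral_prod _ (by fun_prop)]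
  simp

theorem map_compProd_teamKernel_right (P : Measure (𝓧 × 𝓨₁ × 𝓨₂)) [SFinite P]
    (π₁ : Kernel 𝓨₁ 𝓤₁) (π₂ : Kernel 𝓨₂ 𝓤₂) [IsMarkovKernel π₁] [IsMarkovKernel π₂] :
    (P ⊗ₘ teamKernel π₁ π₂).map (fun p => (p.1.2.2, p.2.2)) =
      (P.map fun ω => ω.2.2) ⊗ₘ π₂ := by
  refine Measure.ext_of_lintegral _ fun f hf => ?_
  rw [lintegral_map hf (by fun_prop), Measure.lintegral_compProd (by fun_prop),
    Measure.lintegral_compProd hf, lintegral_map (by fun_prop) (by fun_prop)]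
  refine lintegral_congr fun ω => ?_
  rw [teamKernel_apply, lintegral_prod _ (by fun_prop)]
  simp

end TeamLaw

/-! ### Replacing randomized strategies by deterministic ones -/

section Determinization

/-- A randomized decision can be replaced by a deterministic one without increasing the cost. -/
theorem exists_measurable_lintegral_le {Ω Y U W : Type*} [MeasurableSpace Ω] [MeasurableSpace Y]
    [MeasurableSpace U] [StandardBorelSpace U] [Nonempty U] [MeasurableSpace W]
    (P : Measure Ω) [SFinite P] {y : Ω → Y} (hy : Measurable y)
    (π : Kernel Y U) [IsMarkovKernel π] (K : Kernel Ω W) [IsSFiniteKernel K]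
    {c : Ω × U × W → ℝ≥0∞} (hc : Measurable c) :
    ∃ γ : Y → U, Measurable γ ∧ ∫⁻ ω, ∫⁻ w, c (ω, γ (y ω), w) ∂(K ω) ∂P ≤
      ∫⁻ ω, ∫⁻ u, ∫⁻ w, c (ω, u, w) ∂(K ω) ∂(π (y ω)) ∂P := by
  -- Private randomization: `π y` is the law of `f y t` for uniform `t`, so the cost is an average
  -- over `t` of costs of deterministic maps.
  obtain ⟨f, hf, hfπ⟩ := π.exists_measurable_map_eq_unitInterval
  have hG : Measurable fun q : Ω × U => ∫⁻ w, c (q.1, q.2, w) ∂(K q.1) :=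
    Measurable.lintegral_kernel_prod_right'
      (κ := K.comap (fun q : Ω × U => q.1) measurable_fst)
      (f := fun q : (Ω × U) × W => c (q.1.1, q.1.2, q.2)) (by fun_prop)
  have hf' : Measurable fun q : Ω × unitInterval => f (y q.1) q.2 :=
    hf.comp ((hy.comp measurable_fst).prodMk measurable_snd)
  have hG' : Measurable fun q : Ω × unitInterval => ∫⁻ w, c (q.1, f (y q.1) q.2, w) ∂(K q.1) :=
    hG.comp (measurable_fst.prodMk hf')
  have heq : ∫⁻ ω, ∫⁻ u, ∫⁻ w, c (ω, u, w) ∂(K ω) ∂(π (y ω)) ∂P =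
      ∫⁻ t, ∫⁻ ω, ∫⁻ w, c (ω, f (y ω) t, w) ∂(K ω) ∂P := by
    rw [lintegral_lintegral_swap]
    · refine lintegral_congr fun ω => ?_
      rw [← hfπ, lintegral_map]
      · exact hG.comp measurable_prodMk_left
      · exact hf.comp measurable_prodMk_left
    · exact (hG'.comp measurable_swap).aemeasurable
  obtain ⟨t, ht⟩ := exists_le_lintegral (μ := (volume : Measure unitInterval))
    (f := fun t => ∫⁻ ω, ∫⁻ w, c (ω, f (y ω) t, w) ∂(K ω) ∂P)
    (Measurable.lintegral_prod_right' (hG'.comp measurable_swap)).aemeasurable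
  exact ⟨fun y => f y t, hf.comp measurable_prodMk_right, heq ▸ ht⟩

variable {𝓧 𝓨₁ 𝓨₂ 𝓤₁ 𝓤₂ : Type*} [MeasurableSpace 𝓧] [MeasurableSpace 𝓨₁] [MeasurableSpace 𝓨₂]
  [MeasurableSpace 𝓤₁] [StandardBorelSpace 𝓤₁] [Nonempty 𝓤₁]
  [MeasurableSpace 𝓤₂] [StandardBorelSpace 𝓤₂] [Nonempty 𝓤₂]

/-- One agent at a time: `γ₁` is chosen against `π₂`, then `γ₂` against the already deterministic
`γ₁`. -/
theorem exists_deterministic_expectedCost_le {P : Measure (𝓧 × 𝓨₁ × 𝓨₂)} [SFinite P]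
    {c : 𝓧 × 𝓨₁ × 𝓨₂ → 𝓤₁ → 𝓤₂ → ℝ≥0}
    (hc : Measurable fun p : (𝓧 × 𝓨₁ × 𝓨₂) × 𝓤₁ × 𝓤₂ => c p.1 p.2.1 p.2.2)
    (π₁ : Kernel 𝓨₁ 𝓤₁) (π₂ : Kernel 𝓨₂ 𝓤₂) [IsMarkovKernel π₁] [IsMarkovKernel π₂] :
    ∃ (γ₁ : 𝓨₁ → 𝓤₁) (γ₂ : 𝓨₂ → 𝓤₂) (h₁ : Measurable γ₁) (h₂ : Measurable γ₂),
      expectedCost P c (Kernel.deterministic γ₁ h₁) (Kernel.deterministic γ₂ h₂) ≤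
        expectedCost P c π₁ π₂ := by
  have hcω : ∀ ω, Measurable fun u : 𝓤₁ × 𝓤₂ => (c ω u.1 u.2 : ℝ≥0∞) := fun ω =>
    (hc.comp measurable_prodMk_left).coe_nnreal_ennreal
  have hcost : ∀ (κ₁ : Kernel 𝓨₁ 𝓤₁) (κ₂ : Kernel 𝓨₂ 𝓤₂) [IsMarkovKernel κ₁]
      [IsMarkovKernel κ₂], expectedCost P c κ₁ κ₂ =
        ∫⁻ ω, ∫⁻ u₁, ∫⁻ u₂, (c ω u₁ u₂ : ℝ≥0∞) ∂(κ₂ ω.2.2) ∂(κ₁ ω.2.1) ∂P := fun κ₁ κ₂ _ _ =>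
    lintegral_congr fun ω => lintegral_prod _ (hcω ω).aemeasurable
  have hcost' : ∀ (κ₁ : Kernel 𝓨₁ 𝓤₁) (κ₂ : Kernel 𝓨₂ 𝓤₂) [IsMarkovKernel κ₁]
      [IsMarkovKernel κ₂], expectedCost P c κ₁ κ₂ =
        ∫⁻ ω, ∫⁻ u₂, ∫⁻ u₁, (c ω u₁ u₂ : ℝ≥0∞) ∂(κ₁ ω.2.1) ∂(κ₂ ω.2.2) ∂P := fun κ₁ κ₂ _ _ =>
    lintegral_congr fun ω => lintegral_prod_symm _ (hcω ω).aemeasurable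
  have hy₁ : Measurable fun ω : 𝓧 × 𝓨₁ × 𝓨₂ => ω.2.1 := by fun_prop
  have hy₂ : Measurable fun ω : 𝓧 × 𝓨₁ × 𝓨₂ => ω.2.2 := by fun_prop
  obtain ⟨γ₁, h₁, hγ₁⟩ := exists_measurable_lintegral_le P hy₁ π₁ (π₂.comap _ hy₂)
    (c := fun p => (c p.1 p.2.1 p.2.2 : ℝ≥0∞)) hc.coe_nnreal_ennreal
  obtain ⟨γ₂, h₂, hγ₂⟩ := exists_measurable_lintegral_le P hy₂ π₂
    ((Kernel.deterministic γ₁ h₁).comap _ hy₁)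
    (c := fun p => (c p.1 p.2.2 p.2.1 : ℝ≥0∞))
    (hc.comp (measurable_fst.prodMk (measurable_swap.comp measurable_snd))).coe_nnreal_ennreal
  refine ⟨γ₁, γ₂, h₁, h₂, ?_⟩
  calc expectedCost P c (Kernel.deterministic γ₁ h₁) (Kernel.deterministic γ₂ h₂)
      ≤ expectedCost P c (Kernel.deterministic γ₁ h₁) π₂ := by
        rw [hcost', hcost']
        refine le_trans (le_of_eq ?_) hγ₂
        refine lintegral_congr fun ω => ?_
        simp only [Kernel.deterministic_apply (f := γ₂)]
        rw [lintegral_dirac']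
        · rfl
        · exact ((hcω ω).comp measurable_swap).lintegral_prod_right'
    _ ≤ expectedCost P c π₁ π₂ := by
        rw [hcost, hcost]
        refine le_trans (le_of_eq ?_) hγ₁
        refine lintegral_congr fun ω => ?_
        simp only [Kernel.deterministic_apply (f := γ₁)]
        rw [lintegral_dirac']
        · rfl
        · exact (hcω ω).lintegral_prod_right'

end Determinization

/-! ### Tightness and compactness of strategies -/

/-- The local alternative (ii) implies (i): cover `K` by finitely many neighborhoods and take the
union of their sets `L`. -/
theorem ClassIC.exists_isCompact_of_isCompact {α β κ : Type*} [TopologicalSpace α]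
    [MeasurableSpace α] [TopologicalSpace β] [MeasurableSpace β] [MeasurableSpace κ]
    {φ : α → β → κ → ℝ≥0} (h : ClassIC φ) {M : ℝ≥0} (hM : 0 < M) {K : Set α} (hK : IsCompact K) :
    ∃ L : Set β, IsCompact L ∧ ∀ a ∈ K, ∀ b ∉ L, ∀ k, M ≤ φ a b k := by
  rcases h.2 with h | h
  · exact h M hM K hK
  · refine hK.induction_on (p := fun K => ∃ L : Set β, IsCompact L ∧
      ∀ a ∈ K, ∀ b ∉ L, ∀ k, M ≤ φ a b k) ⟨∅, isCompact_empty, by simp⟩ ?_ ?_ ?_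
    · rintro s t hst ⟨L, hL, H⟩
      exact ⟨L, hL, fun a ha => H a (hst ha)⟩
    · rintro s t ⟨L, hL, H⟩ ⟨L', hL', H'⟩
      refine ⟨L ∪ L', hL.union hL', fun a ha b hb k => ?_⟩
      rcases ha with ha | ha
      · exact H a ha b (fun h => hb (Or.inl h)) k
      · exact H' a ha b (fun h => hb (Or.inr h)) k
    · intro a _
      obtain ⟨O, hO, haO, L, hL, H⟩ := h M hM a
      exact ⟨O, mem_nhdsWithin_of_mem_nhds (hO.mem_nhds haO), L, hL, H⟩

/-- A bound on the expectation of a function of class `IC` makes the laws of its second argument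
uniformly tight. -/
theorem ClassIC.exists_isCompact_measure_le {α β κ Ω : Type*} [TopologicalSpace α] [PolishSpace α]
    [MeasurableSpace α] [BorelSpace α] [TopologicalSpace β] [MeasurableSpace β]
    [MeasurableSpace κ] [MeasurableSpace Ω] {φ : α → β → κ → ℝ≥0} (h : ClassIC φ)
    (P : Measure α) [IsFiniteMeasure P] {A : Ω → α} {B : Ω → β} {k : Ω → κ} (hA : Measurable A)
    (hB : Measurable B) (hk : Measurable k) (C : ℝ≥0) {ε : ℝ≥0∞} (hε : 0 < ε) :
    ∃ L : Set β, IsCompact L ∧ ∀ N : Measure Ω, N.map A = P →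
      ∫⁻ ω, (φ (A ω) (B ω) (k ω) : ℝ≥0∞) ∂N ≤ C → N (B ⁻¹' Lᶜ) ≤ ε := by
  obtain ⟨δ, hδ0, hδε⟩ := ENNReal.lt_iff_exists_nnreal_btwn.mp hε
  have hδ : 0 < δ := by simpa using hδ0
  obtain ⟨K, hK, hPK⟩ := isTightMeasureSet_iff_exists_isCompact_measure_compl_le.mp
    (isTightMeasureSet_singleton (μ := P)) ((δ / 2 : ℝ≥0) : ℝ≥0∞)
    (ENNReal.coe_pos.mpr (half_pos hδ))
  -- Markov's inequality then gives `C / M ≤ δ / 2`; the `+ 1` keeps `M` positive when `C = 0`.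
  set M : ℝ≥0 := (C + 1) / (δ / 2) with hMdef
  have hM : 0 < M := by positivity
  obtain ⟨L, hL, H⟩ := h.exists_isCompact_of_isCompact hM hK
  refine ⟨L, hL, fun N hN hC => ?_⟩
  have hφ : Measurable fun ω => (φ (A ω) (B ω) (k ω) : ℝ≥0∞) :=
    (h.1.comp (hA.prodMk (hB.prodMk hk))).coe_nnreal_ennreal
  have h1 : N (A ⁻¹' Kᶜ) ≤ (δ / 2 : ℝ≥0) := by
    rw [← Measure.map_apply hA hK.isClosed.measurableSet.compl, hN]
    exact hPK P rfl
  have h2 : N {ω | (M : ℝ≥0∞) ≤ φ (A ω) (B ω) (k ω)} ≤ (δ / 2 : ℝ≥0) := by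
    refine (meas_ge_le_lintegral_div hφ.aemeasurable (by simpa using hM.ne')
      ENNReal.coe_ne_top).trans ?_
    refine (ENNReal.div_le_div_right hC _).trans ?_
    rw [← ENNReal.coe_div hM.ne', ENNReal.coe_le_coe, hMdef]
    rw [div_le_iff₀ hM, hMdef, mul_div_cancel₀ _ (by positivity)]
    exact le_self_add
  calc N (B ⁻¹' Lᶜ) ≤ N (A ⁻¹' Kᶜ ∪ {ω | (M : ℝ≥0∞) ≤ φ (A ω) (B ω) (k ω)}) := by
        refine measure_mono fun ω hω => ?_
        by_cases hωK : A ω ∈ K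
        · exact Or.inr (ENNReal.coe_le_coe.mpr (H _ hωK _ hω _))
        · exact Or.inl hωK
    _ ≤ (δ / 2 : ℝ≥0) + (δ / 2 : ℝ≥0) := (measure_union_le _ _).trans (add_le_add h1 h2)
    _ = δ := by rw [← ENNReal.coe_add, add_halves]
    _ ≤ ε := hδε.le

/-- The probability measure `μ ⊗ₘ κ`. -/
noncomputable def probCompProd {α β : Type*} [MeasurableSpace α] [MeasurableSpace β]
    (μ : Measure α) [IsProbabilityMeasure μ] (κ : Kernel α β) [IsMarkovKernel κ] :
    ProbabilityMeasure (α × β) :=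
  ⟨μ ⊗ₘ κ, inferInstance⟩

theorem toMeasure_probCompProd {α β : Type*} [MeasurableSpace α] [MeasurableSpace β]
    (μ : Measure α) [IsProbabilityMeasure μ] (κ : Kernel α β) [IsMarkovKernel κ] :
    (probCompProd μ κ : Measure (α × β)) = μ ⊗ₘ κ :=
  rfl

/-- Sequential compactness of Markov kernels whose laws on the target are uniformly tight, for the
weak convergence of the joint laws with a fixed first marginal. -/
theorem exists_kernel_tendsto_subseq {Y U : Type*} [TopologicalSpace Y] [PolishSpace Y]
    [MeasurableSpace Y] [BorelSpace Y] [TopologicalSpace U] [PolishSpace U]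
    [MeasurableSpace U] [BorelSpace U] [Nonempty U] (μ : Measure Y) [IsProbabilityMeasure μ]
    (m : ℕ → ProbabilityMeasure (Y × U)) (hm : ∀ n, (m n : Measure (Y × U)).fst = μ)
    (htight : ∀ ε : ℝ≥0∞, 0 < ε → ∃ L : Set U, IsCompact L ∧
      ∀ n, (m n : Measure (Y × U)) (Prod.snd ⁻¹' Lᶜ) ≤ ε) :
    ∃ (π : Kernel Y U) (_ : IsMarkovKernel π) (φ : ℕ → ℕ), StrictMono φ ∧
      Tendsto (m ∘ φ) atTop (𝓝 (probCompProd μ π)) := by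
  have hT : IsTightMeasureSet
      {((ν : ProbabilityMeasure (Y × U)) : Measure (Y × U)) | ν ∈ Set.range m} := by
    rw [isTightMeasureSet_iff_exists_isCompact_measure_compl_le]
    intro ε hε
    have hε2 : 0 < ε / 2 := ENNReal.half_pos hε.ne'
    obtain ⟨K, hK, hμK⟩ := isTightMeasureSet_iff_exists_isCompact_measure_compl_le.mp
      (isTightMeasureSet_singleton (μ := μ)) (ε / 2) hε2
    obtain ⟨L, hL, hmL⟩ := htight (ε / 2) hε2
    refine ⟨K ×ˢ L, hK.prod hL, ?_⟩
    rintro _ ⟨_, ⟨n, rfl⟩, rfl⟩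
    have h1 : (m n : Measure (Y × U)) (Prod.fst ⁻¹' Kᶜ) ≤ ε / 2 := by
      rw [← Measure.fst_apply hK.isClosed.measurableSet.compl, hm]
      exact hμK μ rfl
    calc (m n : Measure (Y × U)) (K ×ˢ L)ᶜ
        ≤ (m n : Measure (Y × U)) (Prod.fst ⁻¹' Kᶜ ∪ Prod.snd ⁻¹' Lᶜ) := by
          refine measure_mono fun p hp => ?_
          by_contra hcon
          simp_all
      _ ≤ ε / 2 + ε / 2 := (measure_union_le _ _).trans (add_le_add h1 (hmL n))
      _ = ε := ENNReal.add_halves ε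
  obtain ⟨m', -, φ, hφ, hlim⟩ := (isCompact_closure_of_isTightMeasureSet hT).tendsto_subseq
    (fun n => subset_closure (Set.mem_range_self n))
  -- The limit keeps the first marginal, so disintegrating it yields a kernel over `μ` itself.
  have hm' : (m' : Measure (Y × U)).fst = μ := by
    have h1 : Tendsto (fun n => (m (φ n)).map (f := Prod.fst) measurable_fst.aemeasurable) atTop
        (𝓝 (m'.map (f := Prod.fst) measurable_fst.aemeasurable)) :=
      ((ProbabilityMeasure.continuous_map (Ω := Y × U) continuous_fst).tendsto m').comp hlim
    have h2 : ∀ n, (m (φ n)).map (f := Prod.fst) measurable_fst.aemeasurable =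
        (⟨μ, inferInstance⟩ : ProbabilityMeasure Y) := fun n => Subtype.ext (hm (φ n))
    exact congrArg ProbabilityMeasure.toMeasure
      (tendsto_nhds_unique (h1.congr h2) tendsto_const_nhds)
  refine ⟨(m' : Measure (Y × U)).condKernel, inferInstance, φ, hφ, ?_⟩
  have heq : probCompProd μ (m' : Measure (Y × U)).condKernel = m' :=
    Subtype.ext ((congrArg (· ⊗ₘ (m' : Measure (Y × U)).condKernel) hm'.symm).trans
      (Measure.disintegrate _ _))
  rwa [heq]

/-! ### Existence of an optimal pair by the direct method -/

section Existence

variable {𝓧 𝓨₁ 𝓨₂ 𝓤₁ 𝓤₂ : Type*}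
  [TopologicalSpace 𝓧] [PolishSpace 𝓧] [MeasurableSpace 𝓧] [BorelSpace 𝓧]
  [TopologicalSpace 𝓨₁] [PolishSpace 𝓨₁] [MeasurableSpace 𝓨₁] [BorelSpace 𝓨₁]
  [TopologicalSpace 𝓨₂] [PolishSpace 𝓨₂] [MeasurableSpace 𝓨₂] [BorelSpace 𝓨₂]
  [TopologicalSpace 𝓤₁] [PolishSpace 𝓤₁] [MeasurableSpace 𝓤₁] [BorelSpace 𝓤₁]
  [TopologicalSpace 𝓤₂] [PolishSpace 𝓤₂] [MeasurableSpace 𝓤₂] [BorelSpace 𝓤₂]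

/-- The expected cost is lower semicontinuous along weakly converging joint laws of observation and
action, when the law of `(x, y₁, y₂)` is dominated by a product measure. -/
theorem expectedCost_le_liminf {P : Measure (𝓧 × 𝓨₁ × 𝓨₂)} [IsProbabilityMeasure P]
    {μ : Measure 𝓧} {μ₁ : Measure 𝓨₁} {μ₂ : Measure 𝓨₂} [IsProbabilityMeasure μ]
    [IsProbabilityMeasure μ₁] [IsProbabilityMeasure μ₂] (hP : P ≪ μ.prod (μ₁.prod μ₂))
    {c : 𝓧 × 𝓨₁ × 𝓨₂ → 𝓤₁ → 𝓤₂ → ℝ≥0}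
    (hc : Continuous fun p : (𝓧 × 𝓨₁ × 𝓨₂) × 𝓤₁ × 𝓤₂ => c p.1 p.2.1 p.2.2)
    {κ₁ : ℕ → Kernel 𝓨₁ 𝓤₁} {κ₂ : ℕ → Kernel 𝓨₂ 𝓤₂} [∀ n, IsMarkovKernel (κ₁ n)]
    [∀ n, IsMarkovKernel (κ₂ n)] {π₁ : Kernel 𝓨₁ 𝓤₁} {π₂ : Kernel 𝓨₂ 𝓤₂} [IsMarkovKernel π₁]
    [IsMarkovKernel π₂]
    (h₁ : Tendsto (fun n => probCompProd μ₁ (κ₁ n)) atTop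
      (𝓝 (probCompProd μ₁ π₁)))
    (h₂ : Tendsto (fun n => probCompProd μ₂ (κ₂ n)) atTop
      (𝓝 (probCompProd μ₂ π₂))) :
    expectedCost P c π₁ π₂ ≤ liminf (fun n => expectedCost P c (κ₁ n) (κ₂ n)) atTop := by
  set Q := μ.prod (μ₁.prod μ₂) with hQ
  set D := P.rnDeriv Q with hD
  have hPD : Q.withDensity D = P := Measure.withDensity_rnDeriv_eq P Q hP
  let e : 𝓧 × (𝓨₁ × 𝓤₁) × (𝓨₂ × 𝓤₂) → (𝓧 × 𝓨₁ × 𝓨₂) × 𝓤₁ × 𝓤₂ :=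
    fun q => ((q.1, q.2.1.1, q.2.2.1), q.2.1.2, q.2.2.2)
  have he : Continuous e := by fun_prop
  -- Each law is the image under `e` of a product of three laws, two of which converge weakly while
  -- the first is constant.
  have hprod : Tendsto (fun n => probCompProd Q (teamKernel (κ₁ n) (κ₂ n))) atTop
      (𝓝 (probCompProd Q (teamKernel π₁ π₂))) := by
    let μ' : ProbabilityMeasure 𝓧 := ⟨μ, inferInstance⟩
    have hlim := ((ProbabilityMeasure.continuous_map he).comp
      (ProbabilityMeasure.continuous_prod.comp
        ((continuous_const (y := μ')).prodMk
          ProbabilityMeasure.continuous_prod))).tendsto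
        ((probCompProd μ₁ π₁, probCompProd μ₂ π₂) :
          ProbabilityMeasure (𝓨₁ × 𝓤₁) × ProbabilityMeasure (𝓨₂ × 𝓤₂)) |>.comp
        (h₁.prodMk_nhds h₂)
    convert hlim using 2
    · exact Subtype.ext (prod_compProd_teamKernel μ μ₁ μ₂ _ _)
    · exact Subtype.ext (prod_compProd_teamKernel μ μ₁ μ₂ _ _)
  have hlaw : Tendsto (fun n => probCompProd P (teamKernel (κ₁ n) (κ₂ n))) atTop
      (𝓝 (probCompProd P (teamKernel π₁ π₂))) := by
    refine tendsto_withDensity_fst (Q := Q) (D := D)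
      (M := fun n => probCompProd Q (teamKernel (κ₁ n) (κ₂ n)))
      (M' := probCompProd Q (teamKernel π₁ π₂)) (fun n => Measure.fst_compProd _ _)
      (Measure.fst_compProd _ _) hprod (Measure.measurable_rnDeriv P Q)
      (Measure.lintegral_rnDeriv_lt_top P Q).ne (fun n => ?_) ?_
    · exact (congrArg (· ⊗ₘ teamKernel (κ₁ n) (κ₂ n)) hPD).symm.trans
        (withDensity_compProd_eq Q (Measure.measurable_rnDeriv P Q) _)
    · exact (congrArg (· ⊗ₘ teamKernel π₁ π₂) hPD).symm.trans
        (withDensity_compProd_eq Q (Measure.measurable_rnDeriv P Q) _)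
  rw [expectedCost_eq_lintegral_compProd hc.measurable]
  simp_rw [expectedCost_eq_lintegral_compProd hc.measurable]
  -- Portmanteau for a nonnegative continuous, possibly unbounded, cost.
  have := lintegral_le_liminf_lintegral_of_forall_isOpen_measure_le_liminf_measure
    (f := fun p : (𝓧 × 𝓨₁ × 𝓨₂) × 𝓤₁ × 𝓤₂ => (c p.1 p.2.1 p.2.2 : ℝ))
    (NNReal.continuous_coe.comp hc) (fun p => NNReal.coe_nonneg _)
    (fun G hG => ProbabilityMeasure.le_liminf_measure_open_of_tendsto hlaw hG)
  simpa only [ENNReal.ofReal_coe_nnreal, toMeasure_probCompProd] using this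

variable [Nonempty 𝓤₁] [Nonempty 𝓤₂]

theorem exists_isMarkovKernel_forall_expectedCost_le {P : Measure (𝓧 × 𝓨₁ × 𝓨₂)}
    [IsProbabilityMeasure P]
    (hP : P ≪ (P.map (fun ω => ω.1)).prod
      ((P.map (fun ω => ω.2.1)).prod (P.map (fun ω => ω.2.2))))
    {c : 𝓧 × 𝓨₁ × 𝓨₂ → 𝓤₁ → 𝓤₂ → ℝ≥0}
    (hc : Continuous fun p : (𝓧 × 𝓨₁ × 𝓨₂) × 𝓤₁ × 𝓤₂ => c p.1 p.2.1 p.2.2)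
    (hc₁ : ClassIC fun ω u₁ u₂ => c ω u₁ u₂) (hc₂ : ClassIC fun ω u₂ u₁ => c ω u₁ u₂)
    (hfin : ∃ (π₁ : Kernel 𝓨₁ 𝓤₁) (π₂ : Kernel 𝓨₂ 𝓤₂), IsMarkovKernel π₁ ∧ IsMarkovKernel π₂ ∧
      expectedCost P c π₁ π₂ < ∞) :
    ∃ (π₁ : Kernel 𝓨₁ 𝓤₁) (π₂ : Kernel 𝓨₂ 𝓤₂), IsMarkovKernel π₁ ∧ IsMarkovKernel π₂ ∧
      ∀ (κ₁ : Kernel 𝓨₁ 𝓤₁) (κ₂ : Kernel 𝓨₂ 𝓤₂), IsMarkovKernel κ₁ → IsMarkovKernel κ₂ →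
        expectedCost P c π₁ π₂ ≤ expectedCost P c κ₁ κ₂ := by
  have : IsProbabilityMeasure (P.map (fun ω => ω.1)) :=
    Measure.isProbabilityMeasure_map (by fun_prop)
  have : IsProbabilityMeasure (P.map (fun ω => ω.2.1)) :=
    Measure.isProbabilityMeasure_map (by fun_prop)
  have : IsProbabilityMeasure (P.map (fun ω => ω.2.2)) :=
    Measure.isProbabilityMeasure_map (by fun_prop)
  -- Only finite costs are kept, so the first term of a decreasing minimizing sequence is a finite
  -- bound for all of them, as tightness requires.
  set S : Set ℝ≥0∞ := {v | ∃ (π₁ : Kernel 𝓨₁ 𝓤₁) (π₂ : Kernel 𝓨₂ 𝓤₂), IsMarkovKernel π₁ ∧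
    IsMarkovKernel π₂ ∧ v < ∞ ∧ expectedCost P c π₁ π₂ = v} with hS
  have hSne : S.Nonempty := by
    obtain ⟨π₁, π₂, h₁, h₂, h⟩ := hfin
    exact ⟨_, π₁, π₂, h₁, h₂, h, rfl⟩
  obtain ⟨v, hv_anti, hv_lim, hvS⟩ := exists_seq_tendsto_sInf hSne (OrderBot.bddBelow S)
  choose κ₁ κ₂ hκ₁ hκ₂ hvlt hv using hvS
  obtain ⟨C, hC⟩ : ∃ C : ℝ≥0, ∀ n, expectedCost P c (κ₁ n) (κ₂ n) ≤ C := by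
    refine ⟨(v 0).toNNReal, fun n => ?_⟩
    rw [ENNReal.coe_toNNReal (hvlt 0).ne, hv]
    exact hv_anti (Nat.zero_le n)
  have hcost : ∀ n, ∫⁻ p, (c p.1 p.2.1 p.2.2 : ℝ≥0∞) ∂(P ⊗ₘ teamKernel (κ₁ n) (κ₂ n)) ≤ C :=
    fun n => (expectedCost_eq_lintegral_compProd hc.measurable _ _).symm.trans_le (hC n)
  obtain ⟨π₁, hπ₁, φ, hφ, hlim₁⟩ := exists_kernel_tendsto_subseq
    (P.map (fun ω : 𝓧 × 𝓨₁ × 𝓨₂ => ω.2.1))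
    (fun n => probCompProd (P.map (fun ω : 𝓧 × 𝓨₁ × 𝓨₂ => ω.2.1)) (κ₁ n))
    (fun n => Measure.fst_compProd _ _) (fun ε hε => by
      obtain ⟨L, hL, H⟩ := hc₁.exists_isCompact_measure_le P
        (A := fun p : (𝓧 × 𝓨₁ × 𝓨₂) × 𝓤₁ × 𝓤₂ => p.1) (B := fun p => p.2.1) (k := fun p => p.2.2)
        (by fun_prop) (by fun_prop) (by fun_prop) C hε
      refine ⟨L, hL, fun n => ?_⟩
      refine le_trans (le_of_eq ?_)
        (H (P ⊗ₘ teamKernel (κ₁ n) (κ₂ n)) (Measure.fst_compProd _ _) (hcost n))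
      change ((P.map (fun ω => ω.2.1)) ⊗ₘ κ₁ n) _ = _
      rw [← map_compProd_teamKernel_left P (κ₁ n) (κ₂ n), Measure.map_apply (by fun_prop)
        (measurable_snd hL.isClosed.measurableSet.compl)]
      rfl)
  -- Extracted along `φ`, so that both agents converge along `φ ∘ ψ`.
  obtain ⟨π₂, hπ₂, ψ, hψ, hlim₂⟩ := exists_kernel_tendsto_subseq
    (P.map (fun ω : 𝓧 × 𝓨₁ × 𝓨₂ => ω.2.2))
    (fun n => probCompProd (P.map (fun ω : 𝓧 × 𝓨₁ × 𝓨₂ => ω.2.2)) (κ₂ (φ n)))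
    (fun n => Measure.fst_compProd _ _) (fun ε hε => by
      obtain ⟨L, hL, H⟩ := hc₂.exists_isCompact_measure_le P
        (A := fun p : (𝓧 × 𝓨₁ × 𝓨₂) × 𝓤₁ × 𝓤₂ => p.1) (B := fun p => p.2.2) (k := fun p => p.2.1)
        (by fun_prop) (by fun_prop) (by fun_prop) C hε
      refine ⟨L, hL, fun n => ?_⟩
      refine le_trans (le_of_eq ?_) (H (P ⊗ₘ teamKernel (κ₁ (φ n)) (κ₂ (φ n)))
        (Measure.fst_compProd _ _) (hcost (φ n)))
      change ((P.map (fun ω => ω.2.2)) ⊗ₘ κ₂ (φ n)) _ = _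
      rw [← map_compProd_teamKernel_right P (κ₁ (φ n)) (κ₂ (φ n)), Measure.map_apply (by fun_prop)
        (measurable_snd hL.isClosed.measurableSet.compl)]
      rfl)
  refine ⟨π₁, π₂, hπ₁, hπ₂, fun ρ₁ ρ₂ hρ₁ hρ₂ => ?_⟩
  have hle : expectedCost P c π₁ π₂ ≤ sInf S := by
    have h := expectedCost_le_liminf hP hc (κ₁ := fun n => κ₁ (φ (ψ n)))
      (κ₂ := fun n => κ₂ (φ (ψ n))) (hlim₁.comp hψ.tendsto_atTop) hlim₂
    simp_rw [hv] at h
    exact h.trans_eq (hv_lim.comp (hφ.comp hψ).tendsto_atTop).liminf_eq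
  rcases eq_or_ne (expectedCost P c ρ₁ ρ₂) ∞ with htop | htop
  · rw [htop]
    exact le_top
  · exact hle.trans (sInf_le ⟨ρ₁, ρ₂, hρ₁, hρ₂, htop.lt_top, rfl⟩)

theorem admitsDeterministicOptimum_of_classIC {P : Measure (𝓧 × 𝓨₁ × 𝓨₂)}
    [IsProbabilityMeasure P]
    (hP : P ≪ (P.map (fun ω => ω.1)).prod
      ((P.map (fun ω => ω.2.1)).prod (P.map (fun ω => ω.2.2))))
    {c : 𝓧 × 𝓨₁ × 𝓨₂ → 𝓤₁ → 𝓤₂ → ℝ≥0}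
    (hc : Continuous fun p : (𝓧 × 𝓨₁ × 𝓨₂) × 𝓤₁ × 𝓤₂ => c p.1 p.2.1 p.2.2)
    (hc₁ : ClassIC fun ω u₁ u₂ => c ω u₁ u₂) (hc₂ : ClassIC fun ω u₂ u₁ => c ω u₁ u₂)
    (hfin : ∃ (π₁ : Kernel 𝓨₁ 𝓤₁) (π₂ : Kernel 𝓨₂ 𝓤₂), IsMarkovKernel π₁ ∧ IsMarkovKernel π₂ ∧
      expectedCost P c π₁ π₂ < ∞) :
    AdmitsDeterministicOptimum P c := by
  obtain ⟨π₁, π₂, _, _, hopt⟩ :=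
    exists_isMarkovKernel_forall_expectedCost_le hP hc hc₁ hc₂ hfin
  obtain ⟨γ₁, γ₂, h₁, h₂, hγ⟩ := exists_deterministic_expectedCost_le hc.measurable π₁ π₂ (P := P)
  exact ⟨γ₁, γ₂, h₁, h₂, fun ρ₁ ρ₂ hρ₁ hρ₂ => hγ.trans (hopt ρ₁ ρ₂ hρ₁ hρ₂)⟩

end Existence

/-! ### The compact, bounded case and the conclusion -/

theorem classIC_of_compactSpace {α β κ : Type*} [TopologicalSpace α] [MeasurableSpace α]
    [TopologicalSpace β] [CompactSpace β] [MeasurableSpace β] [MeasurableSpace κ]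
    {φ : α → β → κ → ℝ≥0} (hφ : Measurable fun p : α × β × κ => φ p.1 p.2.1 p.2.2) :
    ClassIC φ :=
  ⟨hφ, Or.inl fun _ _ _ _ => ⟨Set.univ, isCompact_univ, fun _ _ b hb => absurd (Set.mem_univ b) hb⟩⟩

theorem expectedCost_lt_top_of_bounded {𝓧 𝓨₁ 𝓨₂ 𝓤₁ 𝓤₂ : Type*} [MeasurableSpace 𝓧]
    [MeasurableSpace 𝓨₁] [MeasurableSpace 𝓨₂] [MeasurableSpace 𝓤₁] [MeasurableSpace 𝓤₂]
    {P : Measure (𝓧 × 𝓨₁ × 𝓨₂)} [IsProbabilityMeasure P] {c : 𝓧 × 𝓨₁ × 𝓨₂ → 𝓤₁ → 𝓤₂ → ℝ≥0}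
    {C : ℝ≥0} (hC : ∀ ω u₁ u₂, c ω u₁ u₂ ≤ C) (π₁ : Kernel 𝓨₁ 𝓤₁) (π₂ : Kernel 𝓨₂ 𝓤₂)
    [IsMarkovKernel π₁] [IsMarkovKernel π₂] : expectedCost P c π₁ π₂ < ∞ := by
  have h : expectedCost P c π₁ π₂ ≤
      ∫⁻ ω, ∫⁻ _, (C : ℝ≥0∞) ∂((π₁ ω.2.1).prod (π₂ ω.2.2)) ∂P :=
    lintegral_mono fun ω => lintegral_mono fun u => ENNReal.coe_le_coe.mpr (hC ω u.1 u.2)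
  refine h.trans_lt ?_
  simp

end StaticTeam

theorem mainTheorem5
    {𝓧 𝓨₁ 𝓨₂ 𝓤₁ 𝓤₂ : Type*}
    [MetricSpace 𝓧] [CompleteSpace 𝓧] [SecondCountableTopology 𝓧] [SigmaCompactSpace 𝓧]
    [Nonempty 𝓧] [MeasurableSpace 𝓧] [BorelSpace 𝓧]
    [MetricSpace 𝓨₁] [CompleteSpace 𝓨₁] [SecondCountableTopology 𝓨₁] [SigmaCompactSpace 𝓨₁]
    [Nonempty 𝓨₁] [MeasurableSpace 𝓨₁] [BorelSpace 𝓨₁]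
    [MetricSpace 𝓨₂] [CompleteSpace 𝓨₂] [SecondCountableTopology 𝓨₂] [SigmaCompactSpace 𝓨₂]
    [Nonempty 𝓨₂] [MeasurableSpace 𝓨₂] [BorelSpace 𝓨₂]
    [TopologicalSpace 𝓤₁] [PolishSpace 𝓤₁] [SigmaCompactSpace 𝓤₁]
    [Nonempty 𝓤₁] [MeasurableSpace 𝓤₁] [BorelSpace 𝓤₁]
    [TopologicalSpace 𝓤₂] [PolishSpace 𝓤₂] [SigmaCompactSpace 𝓤₂]
    [Nonempty 𝓤₂] [MeasurableSpace 𝓤₂] [BorelSpace 𝓤₂]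
    (P : Measure (𝓧 × 𝓨₁ × 𝓨₂)) [IsProbabilityMeasure P]
    (hP : StaticTeam.DegradedObservation P)
    (c : 𝓧 × 𝓨₁ × 𝓨₂ → 𝓤₁ → 𝓤₂ → ℝ≥0)
    (hc : Continuous (fun p : (𝓧 × 𝓨₁ × 𝓨₂) × 𝓤₁ × 𝓤₂ => c p.1 p.2.1 p.2.2)) :
    (CompactSpace 𝓤₁ → CompactSpace 𝓤₂ → (∃ C : ℝ≥0, ∀ ω u₁ u₂, c ω u₁ u₂ ≤ C) →
      StaticTeam.AdmitsDeterministicOptimum P c) ∧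
    (StaticTeam.ClassIC (fun ω u₁ u₂ => c ω u₁ u₂) →
      StaticTeam.ClassIC (fun ω u₂ u₁ => c ω u₁ u₂) →
      (∃ (π₁ : Kernel 𝓨₁ 𝓤₁) (π₂ : Kernel 𝓨₂ 𝓤₂), IsMarkovKernel π₁ ∧ IsMarkovKernel π₂ ∧
        StaticTeam.expectedCost P c π₁ π₂ < ∞) →
      StaticTeam.AdmitsDeterministicOptimum P c) := by
  have hac := hP.absolutelyContinuous_prod_marginals
  refine ⟨fun _ _ ⟨C, hC⟩ => ?_, fun hc₁ hc₂ hfin =>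
    StaticTeam.admitsDeterministicOptimum_of_classIC hac hc hc₁ hc₂ hfin⟩
  have hswap : Continuous fun p : (𝓧 × 𝓨₁ × 𝓨₂) × 𝓤₂ × 𝓤₁ => c p.1 p.2.2 p.2.1 :=
    hc.comp (continuous_fst.prodMk (continuous_swap.comp continuous_snd))
  -- On compact action spaces class `IC` holds vacuously with `L` the whole space; since the cost is
  -- bounded, constant strategies witness finiteness.
  exact StaticTeam.admitsDeterministicOptimum_of_classIC hac hc
    (StaticTeam.classIC_of_compactSpace hc.measurable)
    (StaticTeam.classIC_of_compactSpace hswap.measurable)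
    ⟨Kernel.const _ (Measure.dirac (Classical.arbitrary 𝓤₁)),
      Kernel.const _ (Measure.dirac (Classical.arbitrary 𝓤₂)), inferInstance,
      inferInstance, StaticTeam.expectedCost_lt_top_of_bounded hC _ _⟩
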